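/- Let $\mathbb{K}$ be $\mathbb{R}$ or $\mathbb{C}$; all spaces are assumed to be Hausdorff. For a space $Z$ let $C_b(Z)$ be the algebra of bounded continuous functions $f:Z\to\mathbb{K}$ with the supremum norm, put $\mathrm{Coz}(f)=\{z\in Z: f(z)\neq 0\}$ and $\mathrm{supp}(f)=\mathrm{cl}_Z\,\mathrm{Coz}(f)$, and let $C_0(Z)$ and $C_{00}(Z)$ be the sets of those $f\in C_b(Z)$ that vanish at infinity (that is, $\{z\in Z:|f(z)|\ge\epsilon\}$ is compact for every $\epsilon>0$) and that have compact support, respectively. A cozero-set of $Z$ is a set of the form $\mathrm{Coz}(f)$ with $f\in C_b(Z)$. Let $X$ be a metrizable space that is locally separable, that is, each point of $X$ has a separable open neighborhood. Let $C_s(X)=\{f\in C_b(X):\mathrm{supp}(f)\text{ is separable}\}$, let $\beta X$ be the Stone–Čech compactification of $X$, and let $$\lambda X=\bigcup\{\mathrm{int}_{\beta X}\,\mathrm{cl}_{\beta X}\,C: C\subseteq X\text{ is a separable cozero-set of }X\}\subseteq\beta X .$$ Then $C_s(X)$ is a closed subalgebra of $C_b(X)$, hence a Banach algebra (not necessarily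 unital) under the supremum norm. The space $Y=\lambda X$ is locally compact, and $C_s(X)$ is isometrically isomorphic, as a Banach algebra, to $C_0(Y)$. Such a space is unique up to homeomorphism: if $T$ is a locally compact space such that $C_s(X)$ and $C_0(T)$ are isometrically isomorphic Banach algebras, then $T$ is homeomorphic to $Y$. Moreover, $Y$ is countably compact, $C_0(Y)=C_{00}(Y)$, and if $X$ is not separable, then $Y$ is not normal. -/

import Mathlib

open Set Filter Topology TopologicalSpace
open scoped BoundedContinuousFunction ZeroAtInfty

/-- A space is locally separable if each of its points has a separable open neighborhood. -/
class LocallySeparableSpace (X : Type*) [TopologicalSpace X] : Prop where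
  exists_open_separable : ∀ x : X, ∃ U : Set X, IsOpen U ∧ x ∈ U ∧ SeparableSpace U

theorem separableSpace_coe_iff_isSeparable {X : Type*} [TopologicalSpace X] [MetrizableSpace X]
    (s : Set X) : SeparableSpace s ↔ IsSeparable s := by
  constructor
  · intro h
    have h1 : IsSeparable (univ : Set s) := IsSeparable.of_separableSpace _
    simpa using h1.image continuous_subtype_val
  · exact fun h => h.separableSpace

/-- In a metrizable space the support (the closure of the cozero-set) is separable
exactly when the cozero-set is. -/
theorem separableSpace_tsupport_iff {X E : Type*} [TopologicalSpace X] [MetrizableSpace X] [Zero E]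
    (f : X → E) : SeparableSpace (tsupport f) ↔ IsSeparable (Function.support f) := by
  rw [separableSpace_coe_iff_isSeparable, tsupport, isSeparable_closure]

/-- `C_s(X)`: the bounded continuous `𝕜`-valued functions with separable support, as a (not
necessarily unital) subalgebra of `C_b(X)`. It carries the pointwise operations and the supremum
norm, both inherited from `C_b(X) = X →ᵇ 𝕜`. -/
def separableSupportFunctions (𝕜 X : Type*) [RCLike 𝕜] [TopologicalSpace X] [MetrizableSpace X] :
    NonUnitalSubalgebra 𝕜 (X →ᵇ 𝕜) where
  carrier := {f | SeparableSpace (tsupport f)}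
  zero_mem' := by
    rw [mem_ofPred_eq, separableSpace_tsupport_iff]
    exact countable_empty.isSeparable.mono (by simp)
  add_mem' {f g} hf hg := by
    rw [mem_ofPred_eq, separableSpace_tsupport_iff] at *
    exact (hf.union hg).mono (Function.support_add _ _)
  mul_mem' {f g} hf hg := by
    rw [mem_ofPred_eq, separableSpace_tsupport_iff] at *
    exact hf.mono (Function.support_mul_subset_left _ _)
  smul_mem' c f hf := by
    rw [mem_ofPred_eq, separableSpace_tsupport_iff] at *
    exact hf.mono (Function.support_const_smul_subset c f)

/-- `C_s(X)` with the ring structure and the supremum norm of `C_b(X)`. -/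
noncomputable instance separableSupportFunctions.instNonUnitalNormedRing (𝕜 X : Type*) [RCLike 𝕜]
    [TopologicalSpace X] [MetrizableSpace X] :
    NonUnitalNormedRing (separableSupportFunctions 𝕜 X) :=
  NonUnitalSubalgebra.nonUnitalNormedRing _

/-- `C_s(X)` with the scalar multiplication of `C_b(X)`, as a normed space. -/
noncomputable instance separableSupportFunctions.instNormedSpace (𝕜 X : Type*) [RCLike 𝕜]
    [TopologicalSpace X] [MetrizableSpace X] :
    NormedSpace 𝕜 (separableSupportFunctions 𝕜 X) :=
  inferInstanceAs (NormedSpace 𝕜 (separableSupportFunctions 𝕜 X).toSubmodule)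

/-- `C` is a cozero-set of `X`: the set where some bounded continuous scalar function on `X`
does not vanish. -/
def IsCozeroSet (𝕜 : Type*) {X : Type*} [RCLike 𝕜] [TopologicalSpace X] (C : Set X) : Prop :=
  ∃ f : X →ᵇ 𝕜, Function.support f = C

/-- `λX`: the union of the interiors in `βX` of the closures in `βX` of the separable cozero-sets
of `X`. Subsets of `X` are viewed in `βX` through the canonical map `X → βX`. -/
def lambdaSpace (𝕜 X : Type*) [RCLike 𝕜] [TopologicalSpace X] : Set (StoneCech X) :=
  ⋃ C ∈ {C : Set X | IsCozeroSet 𝕜 C ∧ SeparableSpace C},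
    interior (closure (stoneCechUnit '' C))

/-- Isometric isomorphism of normed algebras over `𝕜` (not necessarily unital): there is a
multiplicative, surjective linear isometry. -/
def IsometricallyIsomorphic (𝕜 A B : Type*) [RCLike 𝕜] [NonUnitalNormedRing A] [NormedSpace 𝕜 A]
    [NonUnitalNormedRing B] [NormedSpace 𝕜 B] : Prop :=
  ∃ e : A ≃ₗᵢ[𝕜] B, ∀ a b : A, e (a * b) = e a * e b

/-! Everything rests on a partition of `X` into open separable pieces, that is, a locally constant
`q : X → J` with separable fibers. A separable set meets only countably many fibers, and conversely
countably many fibers have separable union. Hence `λX` is the directed union, over countable `A ⊆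
J`, of the closures in `βX` of the clopen sets `q ⁻¹' A`, and these closures are compact and clopen
(`mem_lambdaSpace_iff`).

Since countable subsets of `J` are closed under countable unions, any sequence in `λX`, and the
support of any function vanishing at infinity, lies in one compact clopen piece. This gives
countable compactness and `C₀ = C₀₀`. Restriction along the dense map `X → λX` is isometric on
`C₀(λX)`; it is onto `C_s(X)` because the extension to `βX` of a function with separable support
vanishes off one piece. Uniqueness is a Banach–Stone theorem: contractive characters of `C₀(T)` are
point evaluations.

If `X` is not separable, then `J` is uncountable. Indexing points of distinct fibers by `J × ℕ`
gives a grid whose column limits and row limits have disjoint closures that no open sets separate.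
-/

/-! ### Partition into open separable pieces -/

theorem TopologicalSpace.IsSeparable.countable_setOf_inter_nonempty {X ι : Type*} [TopologicalSpace X] {s : Set X}
    (hs : IsSeparable s) {V : ι → Set X} (hV : ∀ i, IsOpen (V i)) (hf : LocallyFinite V) :
    {i | (s ∩ V i).Nonempty}.Countable := by
  obtain ⟨c, hc, hsc⟩ := hs
  refine (hc.biUnion fun x _ => (hf.point_finite x).countable).mono ?_
  rintro i ⟨x, hxs, hxi⟩
  obtain ⟨y, hyi, hyc⟩ := mem_closure_iff.1 (hsc hxs) _ (hV i) hxi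
  exact mem_biUnion hyc hyi

theorem isSeparable_biUnion {X ι : Type*} [TopologicalSpace X] {A : Set ι} (hA : A.Countable)
    {s : ι → Set X} (hs : ∀ i, IsSeparable (s i)) : IsSeparable (⋃ i ∈ A, s i) := by
  have := hA.to_subtype
  rw [biUnion_eq_iUnion]
  exact .iUnion fun i => hs i

/-- A locally separable metrizable space is partitioned into open separable sets. -/
theorem exists_setoid_isOpen_isSeparable (X : Type*) [TopologicalSpace X] [MetrizableSpace X]
    [LocallySeparableSpace X] :
    ∃ r : Setoid X, ∀ x, IsOpen {y | r x y} ∧ IsSeparable {y | r x y} := by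
  let _ := metrizableSpaceMetric X
  choose U hUo hxU hUs using LocallySeparableSpace.exists_open_separable (X := X)
  obtain ⟨V, hVo, hVc, hVf, hVU⟩ := precise_refinement U hUo
    (eq_univ_of_forall fun x => mem_iUnion.2 ⟨x, hxU x⟩)
  have hVs : ∀ i, IsSeparable (V i) := fun i =>
    ((separableSpace_coe_iff_isSeparable _).1 (hUs i)).mono (hVU i)
  let R : X → X → Prop := fun x y => ∃ i, x ∈ V i ∧ y ∈ V i
  refine ⟨Relation.EqvGen.setoid R, fun x => ⟨?_, ?_⟩⟩
  · refine isOpen_iff_mem_nhds.2 fun y hy => ?_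
    obtain ⟨i, hi⟩ := mem_iUnion.1 (hVc.ge (mem_univ y))
    refine mem_of_superset ((hVo i).mem_nhds hi) fun z hz => ?_
    exact Relation.EqvGen.trans _ _ _ hy (Relation.EqvGen.rel _ _ ⟨i, hi, hz⟩)
  -- `N n` indexes the cover members reached from `x` by chains of `n + 1` successively meeting
  -- members. It stays countable because a separable set meets only countably many members of a
  -- locally finite open family. The union `W` of all reached members is saturated for `R`, so it
  -- contains the class of `x`.
  · let N : ℕ → Set X := fun n =>
      Nat.rec {i | x ∈ V i} (fun _ M => ⋃ i ∈ M, {j | (V i ∩ V j).Nonempty}) n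
    have hN : ∀ n, (N n).Countable := fun n => by
      induction n with
      | zero => exact (hVf.point_finite x).countable
      | succ n ih =>
        exact ih.biUnion fun i _ => TopologicalSpace.IsSeparable.countable_setOf_inter_nonempty (hVs i) hVo hVf
    let W : Set X := ⋃ n, ⋃ i ∈ N n, V i
    have hW : IsSeparable W :=
      .iUnion fun n => isSeparable_biUnion (hN n) hVs
    have hRW : ∀ a b, R a b → a ∈ W → b ∈ W := by
      rintro a b ⟨j, haj, hbj⟩ ha
      obtain ⟨n, i, hi, hai⟩ : ∃ n, ∃ i ∈ N n, a ∈ V i := by simpa [W] using ha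
      refine mem_iUnion.2 ⟨n + 1, mem_biUnion (?_ : j ∈ N (n + 1)) hbj⟩
      exact mem_biUnion hi ⟨a, hai, haj⟩
    have hxW : x ∈ W := by
      obtain ⟨i, hi⟩ := mem_iUnion.1 (hVc.ge (mem_univ x))
      exact mem_iUnion.2 ⟨0, mem_biUnion (show i ∈ N 0 from hi) hi⟩
    have key : ∀ a b, Relation.EqvGen R a b → (a ∈ W ↔ b ∈ W) := by
      intro a b h
      induction h with
      | rel a b h =>
        obtain ⟨i, h1, h2⟩ := h
        exact ⟨hRW _ _ ⟨i, h1, h2⟩, hRW _ _ ⟨i, h2, h1⟩⟩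
      | refl => rfl
      | symm _ _ _ ih => exact ih.symm
      | trans _ _ _ _ _ h1 h2 => exact h1.trans h2
    exact hW.mono fun y hy => (key x y hy).1 hxW

theorem exists_isLocallyConstant_isSeparable_fiber (X : Type*) [TopologicalSpace X]
    [MetrizableSpace X] [LocallySeparableSpace X] :
    ∃ (r : Setoid X), IsLocallyConstant (Quotient.mk r) ∧
      ∀ j, IsSeparable (Quotient.mk r ⁻¹' {j}) := by
  obtain ⟨r, hr⟩ := exists_setoid_isOpen_isSeparable X
  have hfib : ∀ x, Quotient.mk r ⁻¹' {Quotient.mk r x} = {y | r x y} := fun x => by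
    ext y
    exact Quotient.eq.trans ⟨r.symm, r.symm⟩
  refine ⟨r, IsLocallyConstant.iff_isOpen_fiber.2 fun j => ?_, fun j => ?_⟩ <;>
    induction j using Quotient.inductionOn with | _ x => ?_
  · rw [hfib]; exact (hr x).1
  · rw [hfib]; exact (hr x).2

theorem IsLocallyConstant.isClopen_preimage {X J : Type*} [TopologicalSpace X] {q : X → J}
    (hq : IsLocallyConstant q) (A : Set J) : IsClopen (q ⁻¹' A) :=
  ⟨isOpen_compl_iff.1 (hq Aᶜ), hq A⟩

theorem IsLocallyConstant.countable_image {X J : Type*} [TopologicalSpace X] {q : X → J}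
    (hq : IsLocallyConstant q) {s : Set X} (hs : IsSeparable s) : (q '' s).Countable := by
  obtain ⟨c, hc, hsc⟩ := hs
  refine (hc.image q).mono ?_
  rintro _ ⟨x, hx, rfl⟩
  obtain ⟨y, hy, hyc⟩ := mem_closure_iff.1 (hsc hx) _ (hq.isOpen_fiber (q x)) rfl
  exact ⟨y, hyc, hy⟩

theorem isSeparable_preimage_of_countable {X J : Type*} [TopologicalSpace X] {q : X → J}
    (hs : ∀ j, IsSeparable (q ⁻¹' {j})) {A : Set J} (hA : A.Countable) :
    IsSeparable (q ⁻¹' A) := by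
  rw [← biUnion_of_singleton A, preimage_iUnion₂]
  exact isSeparable_biUnion hA hs

/-! ### Non-normality -/

/-- A countably compact space carrying a grid `I × ℕ`, with `I` uncountable, which is locally
countable and all of whose subsets have disjoint closures from their complements, is not normal. -/
theorem not_normalSpace_of_uncountable_grid {Y I : Type*} [TopologicalSpace Y]
    [CountablyCompactSpace Y] [Uncountable I] (d : I × ℕ → Y)
    (hsep : ∀ S : Set (I × ℕ), Disjoint (closure (d '' S)) (closure (d '' Sᶜ)))
    (hctbl : ∀ p, ∃ W ∈ 𝓝 p, (d ⁻¹' W).Countable) : ¬ NormalSpace Y := by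
  classical
  intro hn
  -- Accumulation is counted by indices, through `cofinite`, so `d` need not be injective.
  let acc : Set (I × ℕ) → Set Y := fun A => {p | ClusterPt p (map d (cofinite ⊓ 𝓟 A))}
  have hacc : ∀ A : Set (I × ℕ), A.Infinite → (acc A).Nonempty := fun A hA => by
    let e := hA.natEmbedding A
    have hinj : Function.Injective fun n => (e n : I × ℕ) :=
      Subtype.val_injective.comp e.injective
    obtain ⟨p, -, hp⟩ := (CountablyCompactSpace.isCountablyCompact_univ (E := Y)).seq_clusterPt
      (fun n => d (e n)) (Eventually.of_forall fun _ => mem_univ _)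
    refine ⟨p, ClusterPt.mono hp ?_⟩
    have h1 : Tendsto (fun n => (e n : I × ℕ)) atTop (cofinite ⊓ 𝓟 A) := by
      rw [← Nat.cofinite_eq_atTop]
      exact tendsto_inf.2 ⟨hinj.tendsto_cofinite,
        tendsto_principal.2 (Eventually.of_forall fun n => (e n).2)⟩
    have h2 := map_mono (m := d) h1
    rwa [map_map] at h2
  have hmeet : ∀ {A N p}, p ∈ acc A → N ∈ 𝓝 p → ∀ F : Set (I × ℕ), F.Finite →
      ∃ a ∈ A, a ∉ F ∧ d a ∈ N := fun {A N p} hp hN F hF => by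
    have hmem : A \ F ∈ cofinite ⊓ 𝓟 A :=
      mem_of_superset (inter_mem_inf hF.compl_mem_cofinite (mem_principal_self A))
        fun _ h => ⟨h.2, h.1⟩
    obtain ⟨_, hy, ⟨a, ha, rfl⟩⟩ := clusterPt_iff_nonempty.1 hp hN (image_mem_map hmem)
    exact ⟨a, ha.1, ha.2, hy⟩
  let col : I → Set (I × ℕ) := fun i => {a | a.1 = i}
  let row : ℕ → Set (I × ℕ) := fun n => {a | a.2 = n}
  have hdisj : Disjoint (closure (⋃ i, acc (col i))) (closure (⋃ n, acc (row n))) := by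
    rw [disjoint_left]
    intro p hp0 hp1
    obtain ⟨W, hW, hWc⟩ := hctbl p
    have hA : (Prod.fst '' (d ⁻¹' W)).Countable := hWc.image _
    obtain ⟨e, he⟩ := countable_iff_exists_injOn.1 hA
    -- The region above the graph of `e` contains all but finitely many points of each column. As
    -- `e` is injective on the countably many column indices seen by `W`, it contains only finitely
    -- many points of each row within `W`. So a common point `p` would lie in the closures of both
    -- `d '' S` and `d '' Sᶜ`.
    let S : Set (I × ℕ) := {a | e a.1 < a.2}
    refine disjoint_left.1 (hsep S)
      (show p ∈ _ from mem_closure_iff_nhds.2 fun N hN => ?_) (mem_closure_iff_nhds.2 fun N hN => ?_)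
    · obtain ⟨O, hON, hO, hpO⟩ := mem_nhds_iff.1 (inter_mem hN hW)
      obtain ⟨y, hyO, hy⟩ := mem_closure_iff.1 hp0 O hO hpO
      obtain ⟨i, hi⟩ := mem_iUnion.1 hy
      obtain ⟨a, ha, haF, hd⟩ := hmeet hi (hO.mem_nhds hyO) ((fun n => (i, n)) '' Iic (e i))
        ((finite_Iic _).image _)
      refine ⟨d a, (hON hd).1, a, ?_, rfl⟩
      by_contra hS
      obtain rfl : a.1 = i := ha
      exact haF ⟨a.2, mem_Iic.2 (not_lt.1 hS), rfl⟩
    · obtain ⟨O, hON, hO, hpO⟩ := mem_nhds_iff.1 (inter_mem hN hW)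
      obtain ⟨y, hyO, hy⟩ := mem_closure_iff.1 hp1 O hO hpO
      obtain ⟨n, hn⟩ := mem_iUnion.1 hy
      have hfin : ((Prod.fst '' (d ⁻¹' W)) ∩ e ⁻¹' Iio n).Finite :=
        Finite.of_finite_image ((finite_Iio n).subset (by rintro _ ⟨x, hx, rfl⟩; exact hx.2))
          (he.mono inter_subset_left)
      obtain ⟨a, ha, haF, hd⟩ := hmeet hn (hO.mem_nhds hyO) _ (hfin.image fun i => (i, n))
      refine ⟨d a, (hON hd).1, a, fun hS => haF ?_, rfl⟩
      obtain rfl : a.2 = n := ha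
      exact ⟨a.1, ⟨⟨a, (hON hd).2, rfl⟩, hS⟩, rfl⟩
  obtain ⟨U, V, hU, hV, hFU, hFV, hUV⟩ := normal_separation isClosed_closure isClosed_closure hdisj
  -- An infinite exceptional set would accumulate at a point of the closed set inside `U` (for rows,
  -- inside `V`). So `U` contains almost all of each column but only finitely many points of each
  -- row: it meets every column, yet contains only countably many grid points.
  have hcol : ∀ i, (col i \ d ⁻¹' U).Finite := fun i => by
    by_contra h
    obtain ⟨p, hp⟩ := hacc _ h
    have hpi : p ∈ acc (col i) := hp.mono (map_mono (inf_le_inf_left _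
      (principal_mono.2 sdiff_subset)))
    obtain ⟨a, ha, -, hd⟩ := hmeet hp
      (hU.mem_nhds (hFU (subset_closure (mem_iUnion.2 ⟨i, hpi⟩)))) ∅ finite_empty
    exact ha.2 hd
  have hrow : ∀ n, (row n ∩ d ⁻¹' U).Finite := fun n => by
    by_contra h
    obtain ⟨p, hp⟩ := hacc _ h
    have hpi : p ∈ acc (row n) := hp.mono (map_mono (inf_le_inf_left _
      (principal_mono.2 inter_subset_left)))
    obtain ⟨a, ha, -, hd⟩ := hmeet hp
      (hV.mem_nhds (hFV (subset_closure (mem_iUnion.2 ⟨n, hpi⟩)))) ∅ finite_empty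
    exact disjoint_left.1 hUV ha.2 hd
  have hex : ∀ i, ∃ n, d (i, n) ∈ U := fun i => by
    by_contra! h
    refine infinite_univ (α := ℕ) (((hcol i).preimage
      (f := fun n => (i, n)) (fun _ _ _ _ h => (Prod.ext_iff.1 h).2)).subset fun n _ => ?_)
    exact ⟨rfl, h n⟩
  refine not_countable (α := I) ?_
  rw [← countable_univ_iff]
  refine (countable_iUnion fun n => ((hrow n).image Prod.fst).countable).mono fun i _ => ?_
  obtain ⟨n, hn⟩ := hex i
  exact mem_iUnion.2 ⟨n, (i, n), ⟨rfl, hn⟩, rfl⟩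

/-! ### The Banach–Stone theorem for algebras of functions vanishing at infinity -/

namespace ZeroAtInftyContinuousMap

variable {𝕜 : Type*} [RCLike 𝕜] {T Y : Type*} [TopologicalSpace T] [TopologicalSpace Y]

theorem exists_ne_zero_of_isOpen [T2Space T] [LocallyCompactSpace T] (𝕜 : Type*) [RCLike 𝕜]
    {U : Set T} (hU : IsOpen U) {t : T} (ht : t ∈ U) :
    ∃ f : C₀(T, 𝕜), f t ≠ 0 ∧ Function.support f ⊆ U := by
  obtain ⟨f, hf1, hf0, hfc, -⟩ := exists_continuous_one_zero_of_isCompact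
    (isCompact_singleton (x := t)) hU.isClosed_compl (by simpa using ht)
  have hc : HasCompactSupport fun x => (f x : 𝕜) :=
    hfc.comp_left (g := ((↑) : ℝ → 𝕜)) (by simp)
  refine ⟨⟨⟨fun x => (f x : 𝕜), by fun_prop⟩, hc.is_zero_at_infty⟩, ?_, fun x hx => ?_⟩
  · change (f t : 𝕜) ≠ 0
    simp [hf1 (mem_singleton t)]
  · by_contra hxU
    exact hx (by change (f x : 𝕜) = 0; simp [hf0 hxU])

theorem continuous_of_forall_continuous_comp [T2Space T] [LocallyCompactSpace T] (𝕜 : Type*)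
    [RCLike 𝕜] {φ : Y → T} (h : ∀ f : C₀(T, 𝕜), Continuous fun y => f (φ y)) : Continuous φ := by
  refine continuous_iff_continuousAt.2 fun y N hN => ?_
  obtain ⟨U, hUN, hU, hyU⟩ := mem_nhds_iff.1 hN
  obtain ⟨f, hf, hfU⟩ := exists_ne_zero_of_isOpen 𝕜 hU hyU
  exact ((h f).continuousAt.eventually_ne hf).mono fun z hz => hUN (hfU hz)

theorem eq_of_forall_apply_eq [T2Space T] [LocallyCompactSpace T] (𝕜 : Type*) [RCLike 𝕜] {s t : T}
    (h : ∀ f : C₀(T, 𝕜), f s = f t) : s = t := by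
  by_contra hst
  obtain ⟨f, hf, hfU⟩ := exists_ne_zero_of_isOpen 𝕜 (isOpen_compl_singleton (x := t)) hst
  exact hfU (show f t ≠ 0 from h f ▸ hf) rfl

/-- The set on which an element of `C₀(T, 𝕜)` is bounded below by a positive constant
is compact. -/
theorem isCompact_setOf_le_norm (f : C₀(T, 𝕜)) {ε : ℝ} (hε : 0 < ε) :
    IsCompact {t | ε ≤ ‖f t‖} := by
  have hf : ∀ᶠ t in cocompact T, ‖f t‖ < ε :=
    (zero_at_infty f).norm.eventually_lt_const (by simpa using hε)
  obtain ⟨K, hK, hKf⟩ := mem_cocompact.1 hf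
  refine hK.of_isClosed_subset (isClosed_le continuous_const f.continuous.norm) fun t ht => ?_
  by_contra htK
  exact not_lt.2 (show ε ≤ ‖f t‖ from ht) (show ‖f t‖ < ε from hKf htK)

/-- A nonzero contractive character of `C₀(T, 𝕜)` is evaluation at a point. -/
theorem exists_eq_eval (χ : C₀(T, 𝕜) →ₗ[𝕜] 𝕜) (hmul : ∀ f g, χ (f * g) = χ f * χ g)
    (hle : ∀ f, ‖χ f‖ ≤ ‖f‖) (hne : ∃ f, χ f ≠ 0) (hT : ∀ t : T, ∃ f : C₀(T, 𝕜), f t ≠ 0) :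
    ∃ t, ∀ f, χ f = f t := by
  obtain ⟨h, hh⟩ : ∃ h, χ h = 1 := by
    obtain ⟨f, hf⟩ := hne
    exact ⟨(χ f)⁻¹ • f, by simp [hf]⟩
  have hzero : ∃ t, ∀ f, χ f = 0 → f t = 0 := by
    by_contra! hcon
    choose f hf hft using hcon
    have hK := h.isCompact_setOf_le_norm (ε := 1 / 2) (by norm_num)
    obtain ⟨s, hs⟩ := hK.elim_nhds_subcover (fun t => {x | f t x ≠ 0}) fun t _ =>
      (f t).continuous.continuousAt.eventually_ne (hft t)
    -- If the kernel of `χ` had no common zero, this sum of squares `|f t|²` would be a kernel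
    -- element that is positive on the compact set where `|h| ≥ 1/2`.
    let F : C₀(T, 𝕜) := ∑ t ∈ s, star (f t) * f t
    have hχF : χ F = 0 := by
      simp [F, hmul, hf]
    let r : T → ℝ := fun x => ∑ t ∈ s, ‖f t x‖ ^ 2
    have hr0 : ∀ x, 0 ≤ r x := fun x => Finset.sum_nonneg fun _ _ => by positivity
    have hrc : Continuous r := continuous_finsetSum _ fun t _ => (f t).continuous.norm.pow 2
    have hFr : ∀ x, F x = (r x : 𝕜) := fun x => by
      let ev : C₀(T, 𝕜) →+ 𝕜 := ⟨⟨fun f => f x, rfl⟩, fun _ _ => rfl⟩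
      have h1 : F x = ∑ t ∈ s, (star (f t) * f t) x := map_sum ev _ _
      rw [h1]
      simp [r, RCLike.conj_mul]
    have hrK : ∀ x ∈ {x | 1 / 2 ≤ ‖h x‖}, 0 < r x := fun x hx => by
      obtain ⟨t, ht, hxt⟩ := mem_iUnion₂.1 (hs.2 hx)
      exact Finset.sum_pos' (fun _ _ => by positivity) ⟨t, ht, by
        have := norm_pos_iff.2 hxt
        positivity⟩
    obtain ⟨c, hc, hcK⟩ : ∃ c : ℝ, 0 < c ∧ ∀ x ∈ {x | 1 / 2 ≤ ‖h x‖}, c ≤ r x := by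
      rcases eq_empty_or_nonempty {x | 1 / 2 ≤ ‖h x‖} with he | hn
      · exact ⟨1, one_pos, fun x hx => absurd hx (he ▸ notMem_empty x)⟩
      · obtain ⟨x, hx, hmin⟩ := hK.exists_isMinOn hn hrc.continuousOn
        exact ⟨r x, hrK x hx, fun y hy => hmin hy⟩
    have hm : ∀ x, 0 < max (r x) c := fun x => lt_max_of_lt_right hc
    -- Truncating at `c` keeps the reciprocal of `F` bounded. With `g = h k`, the product `g F`
    -- equals `h` where `|h| ≥ 1/2`, and elsewhere `h - g F` is `h` times a factor in `[0, 1]`. Thus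
    -- `‖h - g F‖ ≤ 1/2` although `χ (h - g F) = 1`.
    let k : T →ᵇ 𝕜 := BoundedContinuousFunction.ofNormedAddCommGroup
      (fun x => (((max (r x) c)⁻¹ : ℝ) : 𝕜))
      (RCLike.continuous_ofReal.comp ((hrc.max continuous_const).inv₀ fun x => (hm x).ne'))
      c⁻¹ fun x => by
        rw [RCLike.norm_ofReal, abs_of_pos (inv_pos.2 (hm x))]
        exact inv_anti₀ hc (le_max_right _ _)
    let g : C₀(T, 𝕜) := ⟨⟨fun x => h x * k x, h.continuous.mul k.continuous⟩, by
      refine squeeze_zero_norm (a := fun x => ‖h x‖ * ‖k‖) (fun x => ?_) ?_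
      · rw [norm_mul]
        gcongr
        exact k.norm_coe_le_norm x
      · simpa using (zero_at_infty h).norm.mul_const ‖k‖⟩
    have hsmall : ‖h - g * F‖ ≤ 1 / 2 := by
      rw [← norm_toBCF_eq_norm]
      refine (BoundedContinuousFunction.norm_le (by norm_num)).2 fun x => ?_
      have hx : (h - g * F) x = h x * (((1 - (max (r x) c)⁻¹ * r x : ℝ)) : 𝕜) := by
        rw [sub_apply, mul_apply, hFr]
        change h x - h x * (((max (r x) c)⁻¹ : ℝ) : 𝕜) * (r x : 𝕜) = _
        push_cast
        ring
      change ‖(h - g * F) x‖ ≤ 1 / 2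
      rw [hx, norm_mul, RCLike.norm_ofReal]
      by_cases hxK : 1 / 2 ≤ ‖h x‖
      · have hcr := hcK x hxK
        rw [max_eq_left hcr, inv_mul_cancel₀ (hc.trans_le hcr).ne']
        norm_num
      · have h1 : (max (r x) c)⁻¹ * r x ≤ 1 := by
          rw [inv_mul_le_one₀ (hm x)]
          exact le_max_left _ _
        have h2 : 0 ≤ (max (r x) c)⁻¹ * r x := mul_nonneg (inv_nonneg.2 (hm x).le) (hr0 x)
        have h3 : |1 - (max (r x) c)⁻¹ * r x| ≤ 1 := abs_le.2 ⟨by linarith, by linarith⟩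
        have h4 := not_le.1 hxK
        nlinarith [norm_nonneg (h x), abs_nonneg (1 - (max (r x) c)⁻¹ * r x)]
    have h1 := hle (h - g * F)
    rw [map_sub, hmul, hχF, hh] at h1
    norm_num at h1
    linarith
  obtain ⟨t, ht⟩ := hzero
  -- `f - χ f • h` lies in the kernel, hence vanishes at `t`. Taking `f = h * h` then forces `h t =
  -- 1`.
  have key : ∀ f, f t = χ f * h t := fun f => by
    have := ht (f - χ f • h) (by simp [hh])
    simpa [sub_eq_zero] using this
  have hht : h t ≠ 0 := fun h0 => by
    obtain ⟨f, hf⟩ := hT t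
    exact hf (by rw [key f, h0, mul_zero])
  have h1 : h t = 1 := by
    have := key (h * h)
    rw [hmul, hh, mul_apply] at this
    simpa [hht] using this
  exact ⟨t, fun f => by rw [key f, h1, mul_one]⟩

theorem exists_continuous_forall_apply_eq [T2Space T] [LocallyCompactSpace T] [T2Space Y]
    [LocallyCompactSpace Y] (e : C₀(T, 𝕜) ≃ₗᵢ[𝕜] C₀(Y, 𝕜))
    (hmul : ∀ f g, e (f * g) = e f * e g) :
    ∃ φ : Y → T, Continuous φ ∧ ∀ f y, e f y = f (φ y) := by
  have hpt : ∀ y, ∃ t, ∀ f, e f y = f t := fun y => by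
    refine exists_eq_eval (χ := ⟨⟨fun f => e f y, by simp⟩, by simp⟩) (fun f g => ?_) (fun f => ?_)
      ?_ fun t => ?_
    · change e (f * g) y = e f y * e g y
      rw [hmul, mul_apply]
    · exact ((e f).toBCF.norm_coe_le_norm y).trans (e.norm_map f).le
    · obtain ⟨g, hg, -⟩ := exists_ne_zero_of_isOpen 𝕜 isOpen_univ (mem_univ y)
      exact ⟨e.symm g, by change e (e.symm g) y ≠ 0; simpa using hg⟩
    · obtain ⟨g, hg, -⟩ := exists_ne_zero_of_isOpen 𝕜 isOpen_univ (mem_univ t)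
      exact ⟨g, hg⟩
  choose φ hφ using hpt
  refine ⟨φ, continuous_of_forall_continuous_comp 𝕜 fun f => ?_, fun f y => hφ y f⟩
  simp only [← hφ]
  exact (e f).continuous

theorem nonempty_homeomorph_of_isometricallyIsomorphic [T2Space T] [LocallyCompactSpace T]
    [T2Space Y] [LocallyCompactSpace Y]
    (h : IsometricallyIsomorphic 𝕜 C₀(T, 𝕜) C₀(Y, 𝕜)) : Nonempty (T ≃ₜ Y) := by
  obtain ⟨e, he⟩ := h
  have he' : ∀ f g, e.symm (f * g) = e.symm f * e.symm g := fun f g => e.injective (by simp [he])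
  obtain ⟨φ, hφ, hφe⟩ := exists_continuous_forall_apply_eq e he
  obtain ⟨ψ, hψ, hψe⟩ := exists_continuous_forall_apply_eq e.symm he'
  exact ⟨{  toFun := ψ
            invFun := φ
            left_inv := fun t => eq_of_forall_apply_eq 𝕜 fun f => by
              rw [← hφe, ← hψe, e.symm_apply_apply]
            right_inv := fun y => eq_of_forall_apply_eq 𝕜 fun f => by
              rw [← hψe, ← hφe, e.apply_symm_apply]
            continuous_toFun := hψ
            continuous_invFun := hφ }⟩

end ZeroAtInftyContinuousMap

theorem IsometricallyIsomorphic.symm {𝕜 A B : Type*} [RCLike 𝕜] [NonUnitalNormedRing A]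
    [NormedSpace 𝕜 A] [NonUnitalNormedRing B] [NormedSpace 𝕜 B]
    (h : IsometricallyIsomorphic 𝕜 A B) : IsometricallyIsomorphic 𝕜 B A := by
  obtain ⟨e, he⟩ := h
  exact ⟨e.symm, fun a b => e.injective (by simp [he])⟩

theorem IsometricallyIsomorphic.trans {𝕜 A B C : Type*} [RCLike 𝕜] [NonUnitalNormedRing A]
    [NormedSpace 𝕜 A] [NonUnitalNormedRing B] [NormedSpace 𝕜 B] [NonUnitalNormedRing C]
    [NormedSpace 𝕜 C] (h : IsometricallyIsomorphic 𝕜 A B) (h' : IsometricallyIsomorphic 𝕜 B C) :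
    IsometricallyIsomorphic 𝕜 A C := by
  obtain ⟨e, he⟩ := h
  obtain ⟨e', he'⟩ := h'
  exact ⟨e.trans e', fun a b => by simp [he, he']⟩

/-! ### Clopen sets and bounded functions in the Stone–Čech compactification -/

/-- The indicator of `C` extends continuously to `βX` with values in `Bool`; the closure is the
fiber of this extension over `true`. -/
theorem isClopen_closure_image_stoneCechUnit {X : Type*} [TopologicalSpace X] {C : Set X} (hC : IsClopen C) :
    IsClopen (closure (stoneCechUnit '' C)) ∧
      ∀ x, stoneCechUnit x ∈ closure (stoneCechUnit '' C) ↔ x ∈ C := by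
  have hb : Continuous C.boolIndicator := (continuous_boolIndicator_iff_isClopen C).2 hC
  let F := stoneCechExtend hb
  have hF : Continuous F := continuous_stoneCechExtend hb
  have hFx : ∀ x, F (stoneCechUnit x) = C.boolIndicator x := stoneCechExtend_stoneCechUnit hb
  have hcl : IsClopen (F ⁻¹' {true}) := (isClopen_discrete _).preimage hF
  have hmem : ∀ x, stoneCechUnit x ∈ F ⁻¹' {true} ↔ x ∈ C := fun x => by
    rw [mem_preimage, hFx, mem_singleton_iff, mem_iff_boolIndicator]
  have heq : closure (stoneCechUnit '' C) = F ⁻¹' {true} := by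
    refine Subset.antisymm (closure_minimal ?_ hcl.1) ?_
    · rintro _ ⟨x, hx, rfl⟩
      exact (hmem x).2 hx
    · refine (denseRange_stoneCechUnit.open_subset_closure_inter hcl.2).trans (closure_mono ?_)
      rintro _ ⟨h, x, rfl⟩
      exact ⟨x, (hmem x).1 h, rfl⟩
  rw [heq]
  exact ⟨hcl, hmem⟩

theorem closure_stoneCechUnit_union_compl {X : Type*} [TopologicalSpace X] (C : Set X) :
    closure (stoneCechUnit '' C) ∪ closure (stoneCechUnit '' Cᶜ) = univ := by
  rw [← closure_union, ← image_union, union_compl_self, image_univ,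
    denseRange_stoneCechUnit.closure_range]

theorem BoundedContinuousFunction.exists_stoneCech_extension {𝕜 X : Type*} [RCLike 𝕜]
    [TopologicalSpace X] (f : X →ᵇ 𝕜) :
    ∃ F : C(StoneCech X, 𝕜), ∀ x, F (stoneCechUnit x) = f x := by
  have hf : Continuous fun x => (⟨f x, by simpa using f.norm_coe_le_norm x⟩ :
      Metric.closedBall (0 : 𝕜) ‖f‖) := f.continuous.subtype_mk _
  have : CompactSpace (Metric.closedBall (0 : 𝕜) ‖f‖) :=
    isCompact_iff_compactSpace.1 (isCompact_closedBall _ _)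
  refine ⟨⟨fun p => ((stoneCechExtend hf p : Metric.closedBall (0 : 𝕜) ‖f‖) : 𝕜),
    continuous_subtype_val.comp (continuous_stoneCechExtend hf)⟩, fun x => ?_⟩
  exact congrArg Subtype.val (stoneCechExtend_stoneCechUnit hf x)

theorem IsClopen.isCozeroSet (𝕜 : Type*) {X : Type*} [RCLike 𝕜] [TopologicalSpace X] {C : Set X}
    (hC : IsClopen C) : IsCozeroSet 𝕜 C := by
  classical
  refine ⟨BoundedContinuousFunction.ofNormedAddCommGroup (C.indicator fun _ => (1 : 𝕜))
    (continuous_const.indicator (by simp [hC.frontier_eq])) 1 fun x => ?_, ?_⟩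
  · by_cases hx : x ∈ C <;> simp [hx]
  · ext x
    by_cases hx : x ∈ C <;> simp [hx]

/-! ### Structure of `λX` through the partition -/

section lambdaSpace

variable {𝕜 X J : Type*} [RCLike 𝕜] [TopologicalSpace X] {q : X → J}

theorem isOpen_lambdaSpace (𝕜 X : Type*) [RCLike 𝕜] [TopologicalSpace X] :
    IsOpen (lambdaSpace 𝕜 X) := by
  unfold lambdaSpace
  exact isOpen_biUnion fun _ _ => isOpen_interior

variable (𝕜) in
/-- The trace on `λX` of the closure of the union of the fibers of `q` over `A`. -/
def lambdaPiece (q : X → J) (A : Set J) : Set (lambdaSpace 𝕜 X) :=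
  Subtype.val ⁻¹' closure (stoneCechUnit '' (q ⁻¹' A))

theorem lambdaPiece_mono {A B : Set J} (h : A ⊆ B) : lambdaPiece 𝕜 q A ⊆ lambdaPiece 𝕜 q B :=
  preimage_mono (closure_mono (image_mono (preimage_mono h)))

theorem isClopen_lambdaPiece (hq : IsLocallyConstant q) (A : Set J) :
    IsClopen (lambdaPiece 𝕜 q A) :=
  (isClopen_closure_image_stoneCechUnit (hq.isClopen_preimage A)).1.preimage continuous_subtype_val

theorem disjoint_lambdaPiece_compl (hq : IsLocallyConstant q) (A : Set J) :
    Disjoint (lambdaPiece 𝕜 q A) (lambdaPiece 𝕜 q Aᶜ) := by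
  refine Disjoint.preimage _ (disjoint_left.2 ?_)
  intro p hp hp'
  obtain ⟨_, hx, x, hxA, rfl⟩ :=
    mem_closure_iff.1 hp' _ (isClopen_closure_image_stoneCechUnit (hq.isClopen_preimage A)).1.isOpen hp
  exact hxA (((isClopen_closure_image_stoneCechUnit (hq.isClopen_preimage A)).2 x).1 hx)

theorem lambdaPiece_union_compl (A : Set J) :
    lambdaPiece 𝕜 q A ∪ lambdaPiece 𝕜 q Aᶜ = univ := by
  rw [lambdaPiece, lambdaPiece, ← preimage_union, preimage_compl,
    closure_stoneCechUnit_union_compl, preimage_univ]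

variable [MetrizableSpace X]

/-- A separable cozero-set `C` lies in `q ⁻¹' (q '' C)`, where `q '' C` is countable. Conversely,
for countable `A` the clopen set `q ⁻¹' A` is itself a separable cozero-set, with open closure in
`βX`. -/
theorem mem_lambdaSpace_iff (hq : IsLocallyConstant q) (hs : ∀ j, IsSeparable (q ⁻¹' {j}))
    {p : StoneCech X} : p ∈ lambdaSpace 𝕜 X ↔
      ∃ A : Set J, A.Countable ∧ p ∈ closure (stoneCechUnit '' (q ⁻¹' A)) := by
  simp only [lambdaSpace, mem_iUnion, mem_ofPred_eq, exists_prop]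
  constructor
  · rintro ⟨C, ⟨-, hC⟩, hp⟩
    exact ⟨q '' C, hq.countable_image ((separableSpace_coe_iff_isSeparable C).1 hC),
      closure_mono (image_mono (subset_preimage_image q C)) (interior_subset hp)⟩
  · rintro ⟨A, hA, hp⟩
    have hc : IsClopen (q ⁻¹' A) := hq.isClopen_preimage A
    refine ⟨q ⁻¹' A, ⟨hc.isCozeroSet 𝕜, (separableSpace_coe_iff_isSeparable _).2
      (isSeparable_preimage_of_countable hs hA)⟩, ?_⟩
    rwa [(isClopen_closure_image_stoneCechUnit hc).1.isOpen.interior_eq]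

theorem isCompact_lambdaPiece (hq : IsLocallyConstant q) (hs : ∀ j, IsSeparable (q ⁻¹' {j}))
    {A : Set J} (hA : A.Countable) : IsCompact (lambdaPiece 𝕜 q A) := by
  rw [Subtype.isCompact_iff, lambdaPiece, Subtype.image_preimage_coe, inter_eq_self_of_subset_right]
  · exact isClosed_closure.isCompact
  · exact fun p hp => (mem_lambdaSpace_iff hq hs).2 ⟨A, hA, hp⟩

theorem exists_mem_lambdaPiece (hq : IsLocallyConstant q) (hs : ∀ j, IsSeparable (q ⁻¹' {j}))
    (p : lambdaSpace 𝕜 X) : ∃ A : Set J, A.Countable ∧ p ∈ lambdaPiece 𝕜 q A :=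
  (mem_lambdaSpace_iff hq hs).1 p.2

theorem IsCompact.exists_subset_lambdaPiece (hq : IsLocallyConstant q)
    (hs : ∀ j, IsSeparable (q ⁻¹' {j})) {K : Set (lambdaSpace 𝕜 X)} (hK : IsCompact K) :
    ∃ A : Set J, A.Countable ∧ K ⊆ lambdaPiece 𝕜 q A := by
  refine hK.induction_on ⟨∅, countable_empty, empty_subset _⟩ ?_ ?_ ?_
  · rintro s t hst ⟨A, hA, ht⟩
    exact ⟨A, hA, hst.trans ht⟩
  · rintro s t ⟨A, hA, hsA⟩ ⟨B, hB, htB⟩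
    exact ⟨A ∪ B, hA.union hB, union_subset (hsA.trans (lambdaPiece_mono subset_union_left))
      (htB.trans (lambdaPiece_mono subset_union_right))⟩
  · intro p _
    obtain ⟨A, hA, hp⟩ := exists_mem_lambdaPiece hq hs p
    exact ⟨_, mem_nhdsWithin_of_mem_nhds ((isClopen_lambdaPiece hq A).isOpen.mem_nhds hp),
      A, hA, Subset.rfl⟩

theorem countablyCompactSpace_lambdaSpace (hq : IsLocallyConstant q)
    (hs : ∀ j, IsSeparable (q ⁻¹' {j})) : CountablyCompactSpace (lambdaSpace 𝕜 X) := by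
  refine ⟨.of_seq_clusterPt fun x _ => ?_⟩
  choose A hA hx using fun n => exists_mem_lambdaPiece hq hs (x n)
  obtain ⟨a, -, ha⟩ := (isCompact_lambdaPiece (𝕜 := 𝕜) hq hs
    (countable_iUnion hA)).isCountablyCompact.seq_clusterPt x
      (Eventually.of_forall fun n => lambdaPiece_mono (subset_iUnion A n) (hx n))
  exact ⟨a, mem_univ _, ha⟩

/-- The support is the union of the compact sets `|g| ≥ 1/(n+1)`, each inside one piece, and
countably many pieces lie in one. -/
theorem ZeroAtInftyContinuousMap.exists_support_subset_lambdaPiece (hq : IsLocallyConstant q)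
    (hs : ∀ j, IsSeparable (q ⁻¹' {j})) (g : C₀(lambdaSpace 𝕜 X, 𝕜)) :
    ∃ A : Set J, A.Countable ∧ Function.support g ⊆ lambdaPiece 𝕜 q A := by
  have h : ∀ n : ℕ, ∃ A : Set J, A.Countable ∧
      {y | 1 / ((n : ℝ) + 1) ≤ ‖g y‖} ⊆ lambdaPiece 𝕜 q A := fun n => by
    exact (g.isCompact_setOf_le_norm Nat.one_div_pos_of_nat).exists_subset_lambdaPiece hq hs
  choose A hA hgA using h
  refine ⟨⋃ n, A n, countable_iUnion hA, fun y hy => ?_⟩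
  obtain ⟨n, hn⟩ := exists_nat_one_div_lt (norm_pos_iff.2 hy)
  exact lambdaPiece_mono (subset_iUnion A n) (hgA n hn.le)

theorem ZeroAtInftyContinuousMap.hasCompactSupport_lambdaSpace (hq : IsLocallyConstant q)
    (hs : ∀ j, IsSeparable (q ⁻¹' {j})) (g : C₀(lambdaSpace 𝕜 X, 𝕜)) : HasCompactSupport g := by
  obtain ⟨A, hA, hgA⟩ := g.exists_support_subset_lambdaPiece hq hs
  exact .of_support_subset_isCompact (isCompact_lambdaPiece hq hs hA) hgA

theorem range_toBCF_lambdaSpace (hq : IsLocallyConstant q) (hs : ∀ j, IsSeparable (q ⁻¹' {j})) :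
    range (ZeroAtInftyContinuousMap.toBCF :
      C₀(lambdaSpace 𝕜 X, 𝕜) → (lambdaSpace 𝕜 X →ᵇ 𝕜)) =
        {f : lambdaSpace 𝕜 X →ᵇ 𝕜 | HasCompactSupport f} := by
  refine Subset.antisymm ?_ fun f hf => ?_
  · rintro _ ⟨g, rfl⟩
    exact g.hasCompactSupport_lambdaSpace hq hs
  · exact ⟨⟨f.toContinuousMap, HasCompactSupport.is_zero_at_infty hf⟩, by ext; rfl⟩

theorem stoneCechUnit_mem_lambdaSpace (hq : IsLocallyConstant q)
    (hs : ∀ j, IsSeparable (q ⁻¹' {j})) (x : X) : stoneCechUnit x ∈ lambdaSpace 𝕜 X :=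
  (mem_lambdaSpace_iff hq hs).2
    ⟨{q x}, countable_singleton _, subset_closure (mem_image_of_mem _ rfl)⟩

variable (𝕜) in
/-- The canonical map `X → λX`. -/
def lambdaUnit (hq : IsLocallyConstant q) (hs : ∀ j, IsSeparable (q ⁻¹' {j})) :
    C(X, lambdaSpace 𝕜 X) :=
  ⟨fun x => ⟨stoneCechUnit x, stoneCechUnit_mem_lambdaSpace hq hs x⟩,
    continuous_stoneCechUnit.subtype_mk _⟩

theorem denseRange_lambdaUnit (hq : IsLocallyConstant q) (hs : ∀ j, IsSeparable (q ⁻¹' {j})) :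
    DenseRange (lambdaUnit 𝕜 hq hs) := by
  refine (denseRange_stoneCechUnit.preimage
    (isOpen_lambdaSpace 𝕜 X).isOpenMap_subtype_val).mono ?_
  rintro ⟨_, _⟩ ⟨x, rfl⟩
  exact ⟨x, rfl⟩

theorem lambdaUnit_mem_lambdaPiece (hq : IsLocallyConstant q) (hs : ∀ j, IsSeparable (q ⁻¹' {j}))
    {A : Set J} {x : X} : lambdaUnit 𝕜 hq hs x ∈ lambdaPiece 𝕜 q A ↔ q x ∈ A :=
  (isClopen_closure_image_stoneCechUnit (hq.isClopen_preimage A)).2 x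

theorem not_normalSpace_lambdaSpace (hq : IsLocallyConstant q)
    (hs : ∀ j, IsSeparable (q ⁻¹' {j})) (hsurj : Function.Surjective q) [Uncountable J] :
    ¬ NormalSpace (lambdaSpace 𝕜 X) := by
  have := countablyCompactSpace_lambdaSpace (𝕜 := 𝕜) hq hs
  -- `J` is infinite, so it can be rearranged as a grid with uncountably many columns; each grid
  -- index gets a point of its own fiber.
  obtain ⟨σ⟩ : Nonempty (J × ℕ ≃ J) := Cardinal.eq.1 (by simp)
  let d : J × ℕ → lambdaSpace 𝕜 X := fun a => lambdaUnit 𝕜 hq hs (Function.surjInv hsurj (σ a))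
  have hd : ∀ a A, d a ∈ lambdaPiece 𝕜 q A ↔ σ a ∈ A := fun a A => by
    rw [lambdaUnit_mem_lambdaPiece, Function.surjInv_eq hsurj]
  refine not_normalSpace_of_uncountable_grid d (fun S => ?_) fun p => ?_
  · refine (disjoint_lambdaPiece_compl (𝕜 := 𝕜) hq (σ '' S)).mono
      (closure_minimal ?_ (isClopen_lambdaPiece hq _).isClosed)
      (closure_minimal ?_ (isClopen_lambdaPiece hq _).isClosed)
    · rintro _ ⟨a, ha, rfl⟩
      exact (hd _ _).2 (mem_image_of_mem _ ha)
    · rintro _ ⟨a, ha, rfl⟩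
      exact (hd _ _).2 fun h => ha (by simpa using h)
  · obtain ⟨A, hA, hp⟩ := exists_mem_lambdaPiece hq hs p
    refine ⟨_, (isClopen_lambdaPiece hq A).isOpen.mem_nhds hp, ?_⟩
    exact (hA.preimage σ.injective).mono fun a ha => (hd _ _).1 ha

end lambdaSpace

/-! ### The algebra `C_s(X)` and its identification with `C₀(λX)` -/

/-- The limit of a sequence vanishes wherever all its terms do, so its cozero-set lies in a
countable union of separable sets. -/
theorem isClosed_separableSupportFunctions (𝕜 X : Type*) [RCLike 𝕜] [TopologicalSpace X]
    [MetrizableSpace X] : IsClosed (separableSupportFunctions 𝕜 X : Set (X →ᵇ 𝕜)) := by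
  refine isClosed_of_closure_subset fun f hf => ?_
  obtain ⟨u, hu, hlim⟩ := mem_closure_iff_seq_limit.1 hf
  refine (separableSpace_tsupport_iff f).2 (IsSeparable.mono (s := ⋃ n, Function.support (u n))
    (.iUnion fun n => (separableSpace_tsupport_iff _).1 (hu n)) fun x hx => ?_)
  by_contra hxu
  have h0 : ∀ n, u n x = 0 := by simpa using hxu
  have h1 : Tendsto (fun n => u n x) atTop (𝓝 (f x)) :=
    (BoundedContinuousFunction.tendsto_iff_tendstoUniformly.1 hlim).tendsto_at x
  exact hx (tendsto_nhds_unique h1 (by simp [h0]))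

section restriction

variable {𝕜 X J : Type*} [RCLike 𝕜] [TopologicalSpace X] [MetrizableSpace X] {q : X → J}

theorem compContinuous_lambdaUnit_mem (hq : IsLocallyConstant q)
    (hs : ∀ j, IsSeparable (q ⁻¹' {j})) (g : C₀(lambdaSpace 𝕜 X, 𝕜)) :
    g.toBCF.compContinuous (lambdaUnit 𝕜 hq hs) ∈ separableSupportFunctions 𝕜 X := by
  obtain ⟨A, hA, hgA⟩ := g.exists_support_subset_lambdaPiece hq hs
  refine (separableSpace_tsupport_iff _).2
    ((isSeparable_preimage_of_countable hs hA).mono fun x hx => ?_)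
  exact (lambdaUnit_mem_lambdaPiece hq hs).1 (hgA hx)

/-- Restriction along `X → λX`, as a linear isometry `C₀(λX) → C_s(X)`. -/
noncomputable def lambdaRestrict (hq : IsLocallyConstant q) (hs : ∀ j, IsSeparable (q ⁻¹' {j})) :
    C₀(lambdaSpace 𝕜 X, 𝕜) →ₗᵢ[𝕜] separableSupportFunctions 𝕜 X where
  toFun g := ⟨_, compContinuous_lambdaUnit_mem hq hs g⟩
  map_add' _ _ := rfl
  map_smul' _ _ := rfl
  norm_map' g := by
    change ‖g.toBCF.compContinuous (lambdaUnit 𝕜 hq hs)‖ = ‖g.toBCF‖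
    refine le_antisymm (BoundedContinuousFunction.norm_compContinuous_le _ _) ?_
    refine (BoundedContinuousFunction.norm_le (norm_nonneg _)).2 fun y => ?_
    refine (denseRange_lambdaUnit hq hs).induction_on y
      (isClosed_le g.toBCF.continuous.norm continuous_const) fun x => ?_
    exact (g.toBCF.compContinuous (lambdaUnit 𝕜 hq hs)).norm_coe_le_norm x

theorem lambdaRestrict_surjective (hq : IsLocallyConstant q)
    (hs : ∀ j, IsSeparable (q ⁻¹' {j})) :
    Function.Surjective (lambdaRestrict (𝕜 := 𝕜) hq hs) := by
  rintro ⟨f, hf⟩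
  obtain ⟨F, hF⟩ := f.exists_stoneCech_extension
  have hA : (q '' Function.support f).Countable :=
    hq.countable_image ((separableSpace_tsupport_iff f).1 hf)
  let G : C(lambdaSpace 𝕜 X, 𝕜) := F.comp ⟨Subtype.val, continuous_subtype_val⟩
  have hG : Function.support G ⊆ lambdaPiece 𝕜 q (q '' Function.support f) := by
    intro y hy
    -- Off the piece, `y` is a limit of points of `X` in fibers that miss the support of `f`, so `F`
    -- vanishes at `y` by continuity.
    refine ((lambdaPiece_union_compl (𝕜 := 𝕜) (q := q) _).ge (mem_univ y)).resolve_right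
      fun hy' => hy ?_
    refine closure_minimal (t := F ⁻¹' {0}) ?_ (isClosed_singleton.preimage F.continuous) hy'
    rintro _ ⟨x, hx, rfl⟩
    rw [mem_preimage, hF]
    by_contra hfx
    exact hx (mem_image_of_mem q hfx)
  refine ⟨⟨G, HasCompactSupport.is_zero_at_infty
    (.of_support_subset_isCompact (isCompact_lambdaPiece hq hs hA) hG)⟩, Subtype.ext ?_⟩
  ext x
  exact hF x

theorem isometricallyIsomorphic_lambdaSpace (hq : IsLocallyConstant q)
    (hs : ∀ j, IsSeparable (q ⁻¹' {j})) :
    IsometricallyIsomorphic 𝕜 (separableSupportFunctions 𝕜 X) C₀(lambdaSpace 𝕜 X, 𝕜) := by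
  let e := LinearIsometryEquiv.ofSurjective _ (lambdaRestrict_surjective (𝕜 := 𝕜) hq hs)
  refine ⟨e.symm, fun a b => e.injective ?_⟩
  have hmul : ∀ g h, e (g * h) = e g * e h := fun _ _ => rfl
  rw [hmul, e.apply_symm_apply, e.apply_symm_apply, e.apply_symm_apply]

end restriction

theorem theorem2p9 (𝕜 : Type*) [RCLike 𝕜] (X : Type*) [TopologicalSpace X]
    [MetrizableSpace X] [LocallySeparableSpace X] :
    -- `C_s(X)` is a closed subalgebra of `C_b(X)` and complete, that is, a Banach algebra
    IsClosed (separableSupportFunctions 𝕜 X : Set (X →ᵇ 𝕜)) ∧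
    CompleteSpace (separableSupportFunctions 𝕜 X) ∧
    -- `Y = λX` is locally compact Hausdorff and `C_s(X)` is isometrically isomorphic to `C_0(Y)`
    LocallyCompactSpace (lambdaSpace 𝕜 X) ∧
    T2Space (lambdaSpace 𝕜 X) ∧
    IsometricallyIsomorphic 𝕜 (separableSupportFunctions 𝕜 X) C₀(lambdaSpace 𝕜 X, 𝕜) ∧
    -- uniqueness of `Y` up to homeomorphism
    (∀ (T : Type*) [TopologicalSpace T] [T2Space T] [LocallyCompactSpace T],
      IsometricallyIsomorphic 𝕜 (separableSupportFunctions 𝕜 X) C₀(T, 𝕜) →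
        Nonempty (T ≃ₜ lambdaSpace 𝕜 X)) ∧
    CountablyCompactSpace (lambdaSpace 𝕜 X) ∧
    -- `C_0(Y) = C_00(Y)` as subsets of `C_b(Y)`
    range (ZeroAtInftyContinuousMap.toBCF : C₀(lambdaSpace 𝕜 X, 𝕜) → (lambdaSpace 𝕜 X →ᵇ 𝕜)) =
      {f : lambdaSpace 𝕜 X →ᵇ 𝕜 | HasCompactSupport f} ∧
    (¬ SeparableSpace X → ¬ NormalSpace (lambdaSpace 𝕜 X)) := by

  obtain ⟨r, hq, hs⟩ := exists_isLocallyConstant_isSeparable_fiber X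
  have hlc : LocallyCompactSpace (lambdaSpace 𝕜 X) :=
    (isOpen_lambdaSpace 𝕜 X).locallyCompactSpace
  have hiso := isometricallyIsomorphic_lambdaSpace (𝕜 := 𝕜) hq hs
  have hcl := isClosed_separableSupportFunctions 𝕜 X
  refine ⟨hcl, hcl.completeSpace_coe, hlc, inferInstance, hiso, fun T _ _ _ hT =>
    ZeroAtInftyContinuousMap.nonempty_homeomorph_of_isometricallyIsomorphic
      (hT.symm.trans hiso), countablyCompactSpace_lambdaSpace hq hs,
    range_toBCF_lambdaSpace hq hs, fun hX => ?_⟩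
  have : Uncountable (Quotient r) := by
    by_contra hc
    rw [not_uncountable_iff] at hc
    refine hX (isSeparable_univ_iff.1 ?_)
    simpa using isSeparable_preimage_of_countable hs (to_countable univ)
  exact not_normalSpace_lambdaSpace hq hs Quotient.mk_surjective
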